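/- All graphs are finite, and $0\in\mathbb N$. For a graph $G$ and a set $A$ of vertices of $G$, an $A$-path is a path in $G$ with at least two vertices and both ends in $A$; for a positive integer $d$ it is $d$-coarse if the distance in $G$ between its two ends is at least $d$. The distance between two paths is the minimum distance in $G$ between a vertex of one and a vertex of the other ($\infty$ if there is no connecting path), and $B_G(X,r)$ is the set of vertices of $G$ at distance at most $r$ from the set $X$ in $G$. There exist functions $f:\mathbb N\to\mathbb N$ and $g:\mathbb N^2\to\mathbb N$, namely $f(k)=4k-4$ and $g(k,d)=d\cdot 256^k$, such that for all positive integers $k$ and $d$, for every finite graph $G$ and every subset $A$ of the vertices of $G$, either $G$ contains $k$ $d$-coarse $A$-paths that are pairwise at distance at least $d$ in $G$, or there exists a set $X$ of vertices of $G$ with $|X|\le f(k)$ such that every $g(k,d)$-coarse $A$-path in $G$ contains a vertex of $B_G(X,g(k,d))$. -/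

import Mathlib

namespace CoarseGallai

universe u

variable {V : Type u}

/-- The distance in `G` between two sets of vertices: the minimum length of a path from a vertex
of `X` to a vertex of `Y`, and `⊤` if there is no such path. -/
noncomputable def setDist (G : SimpleGraph V) (X Y : Set V) : ℕ∞ :=
  ⨅ x ∈ X, ⨅ y ∈ Y, G.edist x y

/-- The ball `B_G(X, r)`: all vertices of `G` at distance at most `r` from `X` in `G`. -/
def ball (G : SimpleGraph V) (X : Set V) (r : ℕ) : Set V :=
  {y | setDist G X {y} ≤ (r : ℕ∞)}

/-- An `A`-path in `G`: a path with at least two vertices and both ends in `A`. Internal vertices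
may also lie in `A`. -/
structure APath (G : SimpleGraph V) (A : Set V) where
  fst : V
  snd : V
  walk : G.Walk fst snd
  isPath : walk.IsPath
  two_le : 2 ≤ walk.support.length
  fst_mem : fst ∈ A
  snd_mem : snd ∈ A

/-- The set of vertices of an `A`-path. -/
def APath.verts {G : SimpleGraph V} {A : Set V} (P : APath G A) : Set V :=
  {v | v ∈ P.walk.support}

/-- An `A`-path is `d`-coarse if the distance in `G` between its ends is at least `d`. -/
def APath.IsCoarse {G : SimpleGraph V} {A : Set V} (P : APath G A) (d : ℕ) : Prop :=
  (d : ℕ∞) ≤ G.edist P.fst P.snd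

end CoarseGallai

/-! Keep a list of at most `k` connected components that are pairwise far apart: dipods, holding two
distant vertices of `A`, and tripods, holding three joined through a centre. Each contains a coarse
`A`-path, so `k` of them give the packing. With fewer, the ends and tripod centres number at most `4
* (k - 1)`; if they are not a hitting set, some coarse path `P` avoids large balls around them, and
`IsConfig.step` uses `P` to improve the list. If `P` is far from all components, it is a new dipod.
Otherwise follow `P` from one end to its first approach to a component: a dipod then gains a third
end and yields a tripod (`exists_tripodWith`), while a tripod splits into two dipods
(`IsTripodWith.exists_split`). With weights 4 and 7 these moves add 4, 3 and 1 to the total weight,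
and they divide the separation by at most 2, 8 and 2. So the scale `d * 2 ^ (7 * k - totalWeight l)`
survives every move, and since the weight is at most `7 * k` the process stops at scale at least
`d`. -/

namespace CoarseGallai

universe u

variable {V : Type u} {G : SimpleGraph V}

/-! ### Distances and connected sets. -/

/-- `x` and `y` are at distance at most `n`. -/
def Near (G : SimpleGraph V) (n : ℕ) (x y : V) : Prop := G.edist x y ≤ n

/-- The sets `S` and `T` are at distance at least `n`. -/
def Far (G : SimpleGraph V) (n : ℕ) (S T : Set V) : Prop :=
  ∀ x ∈ S, ∀ y ∈ T, ∀ m, Near G m x y → n ≤ m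

/-- Any two vertices of `S` are joined by a walk inside `S`. -/
def Conn (G : SimpleGraph V) (S : Set V) : Prop :=
  ∀ x ∈ S, ∀ y ∈ S, ∃ w : G.Walk x y, ∀ v ∈ w.support, v ∈ S

theorem Near.symm {n : ℕ} {x y : V} (h : Near G n x y) : Near G n y x := by
  unfold Near at *; rwa [SimpleGraph.edist_comm]

theorem Near.trans {m n : ℕ} {x y z : V} (h : Near G m x y) (h' : Near G n y z) :
    Near G (m + n) x z := by
  unfold Near at *
  push_cast
  exact SimpleGraph.edist_triangle.trans (add_le_add h h')

theorem Near.mono {m n : ℕ} {x y : V} (h : Near G m x y) (hmn : m ≤ n) : Near G n x y :=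
  le_trans h (by exact_mod_cast hmn)

theorem Near.refl (n : ℕ) (x : V) : Near G n x x := by
  simp [Near]

theorem near_of_adj {x y : V} (h : G.Adj x y) : Near G 1 x y := by
  simp [Near, SimpleGraph.edist_eq_one_iff_adj.mpr h]

theorem Near.exists_walk {n : ℕ} {x y : V} (h : Near G n x y) :
    ∃ w : G.Walk x y, w.length ≤ n := by
  have hr : G.Reachable x y :=
    SimpleGraph.reachable_of_edist_ne_top (ne_top_of_le_ne_top (ENat.natCast_ne_top n) h)
  obtain ⟨w, hw⟩ := hr.exists_walk_length_eq_edist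
  refine ⟨w, ?_⟩
  unfold Near at h
  rw [← hw] at h
  exact_mod_cast h

theorem near_of_walk {x y : V} (w : G.Walk x y) : Near G w.length x y :=
  SimpleGraph.edist_le w

theorem le_edist_of_forall_near {n : ℕ} {x y : V} (h : ∀ m, Near G m x y → n ≤ m) :
    (n : ℕ∞) ≤ G.edist x y := by
  cases he : G.edist x y with
  | top => exact le_top
  | coe m => exact_mod_cast h m (by simp [Near, he])

theorem Far.symm {n : ℕ} {S T : Set V} (h : Far G n S T) : Far G n T S :=
  fun x hx y hy m hm => h y hy x hx m hm.symm

theorem Far.mono {m n : ℕ} {S T S' T' : Set V} (h : Far G n S T) (hmn : m ≤ n)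
    (hS : S' ⊆ S) (hT : T' ⊆ T) : Far G m S' T' :=
  fun x hx y hy l hl => hmn.trans (h x (hS hx) y (hT hy) l hl)

theorem Far.union_left {n : ℕ} {S S' T : Set V} (h : Far G n S T) (h' : Far G n S' T) :
    Far G n (S ∪ S') T :=
  fun x hx => hx.elim (h x) (h' x)

theorem Far.union_right {n : ℕ} {S T T' : Set V} (h : Far G n S T) (h' : Far G n S T') :
    Far G n S (T ∪ T') :=
  (h.symm.union_left h'.symm).symm

theorem Far.le_setDist {n : ℕ} {S T : Set V} (h : Far G n S T) : (n : ℕ∞) ≤ setDist G S T :=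
  le_iInf₂ fun x hx => le_iInf₂ fun y hy => le_edist_of_forall_near (h x hx y hy)

theorem conn_singleton (x : V) : Conn G {x} := by
  rintro _ rfl _ rfl
  exact ⟨.nil, by simp⟩

theorem Conn.union {S T : Set V} (hS : Conn G S) (hT : Conn G T) {z : V} (hzS : z ∈ S)
    (hzT : z ∈ T) : Conn G (S ∪ T) := by
  have key : ∀ x ∈ S ∪ T, ∃ w : G.Walk x z, ∀ v ∈ w.support, v ∈ S ∪ T := by
    rintro x (hx | hx)
    · obtain ⟨w, hw⟩ := hS x hx z hzS
      exact ⟨w, fun v hv => .inl (hw v hv)⟩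
    · obtain ⟨w, hw⟩ := hT x hx z hzT
      exact ⟨w, fun v hv => .inr (hw v hv)⟩
  intro x hx y hy
  obtain ⟨w, hw⟩ := key x hx
  obtain ⟨w', hw'⟩ := key y hy
  refine ⟨w.append w'.reverse, fun v hv => ?_⟩
  rw [SimpleGraph.Walk.mem_support_append_iff, SimpleGraph.Walk.support_reverse,
    List.mem_reverse] at hv
  exact hv.elim (hw v) (hw' v)

theorem conn_support {x y : V} (w : G.Walk x y) : Conn G {v | v ∈ w.support} := by
  induction w with
  | nil => simpa using conn_singleton _
  | @cons u v _ h p ih =>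
    have h2 : Conn G ({u, v} : Set V) := by
      have huv : ∃ w : G.Walk u v, ∀ z ∈ w.support, z ∈ ({u, v} : Set V) :=
        ⟨h.toWalk, by simp [SimpleGraph.Adj.toWalk]⟩
      have hvu : ∃ w : G.Walk v u, ∀ z ∈ w.support, z ∈ ({u, v} : Set V) :=
        ⟨h.symm.toWalk, by simp [SimpleGraph.Adj.toWalk]⟩
      have hself : ∀ x ∈ ({u, v} : Set V), ∃ w : G.Walk x x,
          ∀ z ∈ w.support, z ∈ ({u, v} : Set V) := fun x hx => ⟨.nil, by simpa using hx⟩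
      rintro x (rfl | rfl) y (rfl | rfl)
      · exact hself _ (by simp)
      · exact huv
      · exact hvu
      · exact hself _ (by simp)
    have h3 := h2.union ih (z := v) (by simp) (by simp)
    convert h3 using 1
    ext z
    simp only [SimpleGraph.Walk.support_cons, List.mem_cons, Set.mem_ofPred_eq, Set.mem_union,
      Set.mem_insert_iff, Set.mem_singleton_iff]
    have := p.start_mem_support
    grind

/-! ### First hits and hulls of shortest paths. -/

/-- The shortest connected initial piece of a walk that reaches a vertex with property `P`. -/
theorem exists_first_hit {x y : V} (w : G.Walk x y) (P : V → Prop) (hy : P y) :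
    ∃ (S : Set V) (z : V), (∀ v ∈ S, v ∈ w.support) ∧ Conn G S ∧ x ∈ S ∧ z ∈ S ∧ P z ∧
      (∀ v ∈ S, P v → v = z) ∧ (S = {x} ∧ z = x ∨ ∃ v ∈ S, ¬ P v ∧ G.Adj v z) := by
  induction w with
  | nil =>
    exact ⟨{_}, _, by simp, conn_singleton _, rfl, rfl, hy, by simp, .inl ⟨rfl, rfl⟩⟩
  | @cons u v _ h p ih =>
    by_cases hu : P u
    · exact ⟨{u}, u, by simp, conn_singleton _, rfl, rfl, hu, by simp, .inl ⟨rfl, rfl⟩⟩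
    obtain ⟨S, z, hS, hc, hv, hz, hPz, hun, hor⟩ := ih hy
    refine ⟨{a | a ∈ (h.toWalk).support} ∪ S, z, ?_, (conn_support h.toWalk).union hc (z := v)
      (by simp [SimpleGraph.Adj.toWalk]) hv, by simp, .inr hz, hPz, ?_, .inr ?_⟩
    · rintro a (ha | ha)
      · have := p.start_mem_support
        simp [SimpleGraph.Adj.toWalk] at ha ⊢
        grind
      · simp [hS a ha]
    · rintro a (ha | ha) hPa
      · simp [SimpleGraph.Adj.toWalk] at ha
        rcases ha with rfl | rfl
        · exact absurd hPa hu
        · exact hun _ hv hPa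
      · exact hun a ha hPa
    · rcases hor with ⟨-, rfl⟩ | ⟨a, ha, hPa, hadj⟩
      · exact ⟨u, by simp, hu, h⟩
      · exact ⟨a, .inr ha, hPa, hadj⟩

/-- The vertices on shortest paths from `c` to `L`, with total length at most `n`. -/
def hull (G : SimpleGraph V) (n : ℕ) (c : V) (L : Set V) : Set V :=
  {v | ∃ i j, i + j ≤ n ∧ Near G i v c ∧ ∃ x ∈ L, Near G j v x}

theorem conn_hull (n : ℕ) (c : V) (L : Set V) : Conn G (hull G n c L) := by
  have key : ∀ x ∈ hull G n c L, ∃ w : G.Walk x c, ∀ v ∈ w.support, v ∈ hull G n c L := by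
    rintro x ⟨i, j, hij, hi, y, hy, hj⟩
    obtain ⟨w, hw⟩ := hi.exists_walk
    refine ⟨w, fun v hv => ?_⟩
    obtain ⟨q, r, rfl⟩ := SimpleGraph.Walk.mem_support_iff_exists_append.mp hv
    rw [SimpleGraph.Walk.length_append] at hw
    exact ⟨r.length, q.length + j, by omega, near_of_walk r, y, hy,
      (near_of_walk q).symm.trans hj⟩
  intro x hx y hy
  obtain ⟨w, hw⟩ := key x hx
  obtain ⟨w', hw'⟩ := key y hy
  refine ⟨w.append w'.reverse, fun v hv => ?_⟩
  rw [SimpleGraph.Walk.mem_support_append_iff, SimpleGraph.Walk.support_reverse,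
    List.mem_reverse] at hv
  exact hv.elim (hw v) (hw' v)

theorem mem_hull_of_near {n : ℕ} {c x : V} {L : Set V} (hx : x ∈ L) (h : Near G n x c) :
    x ∈ hull G n c L :=
  ⟨n, 0, by omega, h, x, hx, .refl _ _⟩

theorem center_mem_hull {n : ℕ} {c x : V} {L : Set V} (hx : x ∈ L) (h : Near G n x c) :
    c ∈ hull G n c L :=
  ⟨0, n, by omega, .refl _ _, x, hx, h.symm⟩

theorem near_of_mem_hull {n : ℕ} {c v : V} {L : Set V} (h : v ∈ hull G n c L) :
    Near G n v c := by
  obtain ⟨i, j, hij, hi, -⟩ := h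
  exact hi.mono (by omega)

/-! ### Walks as eventually constant sequences. -/

/-- Stuttering is allowed because `getVert` is constant past the end of a walk; tails are then
images of `Set.Ici` with no upper index to track. -/
theorem conn_image_of_ordConnected {e : ℕ → V} (he : ∀ i, e i = e (i + 1) ∨ G.Adj (e i) (e (i + 1)))
    (I : Set ℕ) [hI : I.OrdConnected] : Conn G (e '' I) := by
  have key : ∀ i ∈ I, ∀ n, i + n ∈ I → ∃ w : G.Walk (e i) (e (i + n)),
      ∀ v ∈ w.support, v ∈ e '' I := by
    intro i hi n
    induction n with
    | zero => exact fun _ => ⟨.nil, by simpa using ⟨i, hi, rfl⟩⟩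
    | succ n ih =>
      intro hn
      obtain ⟨w, hw⟩ := ih (hI.out hi hn ⟨by omega, by omega⟩)
      rcases he (i + n) with h | h
      · refine ⟨w.copy rfl h, by simpa using hw⟩
      · refine ⟨w.concat h, fun v hv => ?_⟩
        rw [SimpleGraph.Walk.support_concat, List.mem_append] at hv
        rcases hv with hv | hv
        · exact hw v hv
        · rw [List.mem_singleton] at hv
          exact ⟨_, hn, hv.symm⟩
  rintro _ ⟨i, hi, rfl⟩ _ ⟨j, hj, rfl⟩
  rcases le_total i j with h | h
  · obtain ⟨n, rfl⟩ := Nat.exists_eq_add_of_le h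
    exact key i hi n hj
  · obtain ⟨n, rfl⟩ := Nat.exists_eq_add_of_le h
    obtain ⟨w, hw⟩ := key j hj n hi
    exact ⟨w.reverse, by simpa using hw⟩

theorem near_succ {e : ℕ → V} (he : ∀ i, e i = e (i + 1) ∨ G.Adj (e i) (e (i + 1))) (i : ℕ) :
    Near G 1 (e i) (e (i + 1)) := by
  rcases he i with h | h
  · rw [← h]; exact .refl _ _
  · exact near_of_adj h

/-- The last index up to which a sequence that is constant from `M` on has property `P`. -/
theorem exists_last_index {e : ℕ → V} {M : ℕ} (hM : ∀ i, M ≤ i → e i = e M) (P : V → Prop)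
    {s : ℕ} (hs : s ≤ M) (h : ∃ i, s ≤ i ∧ P (e i)) :
    ∃ p, s ≤ p ∧ p ≤ M ∧ P (e p) ∧ ∀ j, P (e j) → j ≤ p ∨ p = M := by
  classical
  obtain ⟨i, hsi, hi⟩ := h
  have hi' : P (e (min i M)) := by
    rcases le_total i M with h | h
    · rwa [min_eq_left h]
    · rwa [min_eq_right h, ← hM i h]
  refine ⟨Nat.findGreatest (fun j => P (e j)) M, ?_, Nat.findGreatest_le M,
    Nat.findGreatest_spec (P := fun j => P (e j)) (min_le_right i M) hi', fun j hj => ?_⟩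
  · exact (le_min hsi hs).trans
      (Nat.le_findGreatest (P := fun j => P (e j)) (min_le_right i M) hi')
  · rcases le_total j M with h | h
    · exact .inl (Nat.le_findGreatest (P := fun j => P (e j)) h hj)
    · rw [hM j h] at hj
      exact .inr (le_antisymm (Nat.findGreatest_le M)
        (Nat.le_findGreatest (P := fun j => P (e j)) le_rfl hj))

/-- Walking from `x` to `e q` and then along `e`, until `e p` or the property `P` is reached. -/
theorem exists_advance {e : ℕ → V} (he : ∀ i, e i = e (i + 1) ∨ G.Adj (e i) (e (i + 1)))
    {t p q : ℕ} {x : V} (hqp : q ≤ p) (hx : Near G t x (e q)) (P : V → Prop) (hP : P (e p))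
    (hPx : ¬ P x) :
    ∃ (S : Set V) (z : V), S ⊆ hull G t x {e q} ∪ e '' Set.Icc q p ∧ Conn G S ∧ x ∈ S ∧ z ∈ S ∧
      P z ∧ (∀ v ∈ S, P v → v = z) ∧ ∃ v ∈ S, ¬ P v ∧ G.Adj v z := by
  have hc : Conn G (hull G t x {e q} ∪ e '' Set.Icc q p) :=
    (conn_hull t x {e q}).union (conn_image_of_ordConnected he (Set.Icc q p)) (z := e q)
      (mem_hull_of_near rfl hx.symm) ⟨q, ⟨le_rfl, hqp⟩, rfl⟩
  obtain ⟨w, hw⟩ := hc x (.inl (center_mem_hull rfl hx.symm)) (e p)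
    (.inr ⟨p, ⟨hqp, le_rfl⟩, rfl⟩)
  obtain ⟨S, z, hS, hcS, hxS, hzS, hPz, hun, hor⟩ := exists_first_hit w P hP
  refine ⟨S, z, fun v hv => hw v (hS v hv), hcS, hxS, hzS, hPz, hun, ?_⟩
  rcases hor with ⟨-, rfl⟩ | h
  · exact absurd hPz hPx
  · exact h

/-! ### Finding a coarse tripod along a sequence. -/

/-- Two connected sets and the tail of the sequence `e` from the index `s` are the legs of a
tripod with centre `e s`. -/
structure IsTripod (G : SimpleGraph V) (e : ℕ → V) (t s : ℕ) (S T : Set V) : Prop where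
  conn_left : Conn G S
  conn_right : Conn G T
  far : Far G t S T
  far_left : Far G t S (e '' Set.Ici s)
  far_right : Far G t T (e '' Set.Ici s)
  near_left : ∃ x ∈ S, Near G (2 * t) x (e s)
  near_right : ∃ x ∈ T, Near G (2 * t) x (e s)
  subset_left : ∀ x ∈ S, ∃ i, Near G t x (e i)
  subset_right : ∀ x ∈ T, ∃ i, Near G t x (e i)

theorem IsTripod.swap {e : ℕ → V} {t s : ℕ} {S T : Set V} (h : IsTripod G e t s S T) :
    IsTripod G e t s T S :=
  ⟨h.2, h.1, h.3.symm, h.5, h.4, h.7, h.6, h.9, h.8⟩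

/-- Two connected sets at mutual distance at least `t` and at distance exactly `t` from the tail
of `e` from the index `s`. -/
structure IsPretripod (G : SimpleGraph V) (e : ℕ → V) (t s : ℕ) (S T : Set V) : Prop where
  conn_left : Conn G S
  conn_right : Conn G T
  far : Far G t S T
  far_left : Far G t S (e '' Set.Ici s)
  far_right : Far G t T (e '' Set.Ici s)
  near_left : ∃ i, s ≤ i ∧ ∃ x ∈ S, Near G t x (e i)
  near_right : ∃ i, s ≤ i ∧ ∃ x ∈ T, Near G t x (e i)
  subset_left : ∀ x ∈ S, ∃ i, Near G t x (e i)
  subset_right : ∀ x ∈ T, ∃ i, Near G t x (e i)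

theorem IsPretripod.swap {e : ℕ → V} {t s : ℕ} {S T : Set V} (h : IsPretripod G e t s S T) :
    IsPretripod G e t s T S :=
  ⟨h.2, h.1, h.3.symm, h.5, h.4, h.7, h.6, h.9, h.8⟩

theorem tail_subset {e : ℕ → V} {s p : ℕ} (h : s ≤ p) : e '' Set.Ici p ⊆ e '' Set.Ici s :=
  Set.image_mono (Set.Ici_subset_Ici.mpr h)

theorem near_of_mem_advance {e : ℕ → V} {t p q : ℕ} {x v : V}
    (h : v ∈ hull G t x {e q} ∪ e '' Set.Icc q p) : ∃ i, Near G t v (e i) := by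
  rcases h with ⟨i, j, hij, -, y, rfl, hj⟩ | ⟨i, -, rfl⟩
  · exact ⟨q, hj.mono (by omega)⟩
  · exact ⟨i, .refl _ _⟩

/-- A pretripod in which `S` reaches further along `e` than `T` is a tripod or can be moved on. -/
theorem IsPretripod.step {e : ℕ → V} (he : ∀ i, e i = e (i + 1) ∨ G.Adj (e i) (e (i + 1)))
    {t s p q : ℕ} {S T : Set V} (h : IsPretripod G e t s S T) (hsq : s ≤ q) (hqp : q < p)
    (hp : ∃ x ∈ S, Near G t x (e p)) (hq : ∃ x ∈ T, Near G t x (e q))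
    (hlast : ∀ j, (∃ x ∈ T, Near G t x (e j)) → j ≤ q) :
    ∃ T', T ⊆ T' ∧ (IsTripod G e t q S T ∨ IsPretripod G e t p S T') := by
  obtain ⟨x, hx, hxq⟩ := hq
  obtain ⟨S', z, hS', hcS', hxS', hz, ⟨j, hj, hzj⟩, hun, v, hv, hPv, hvz⟩ :=
    exists_advance he hqp.le hxq (fun v => ∃ j, p ≤ j ∧ Near G t v (e j)) ⟨p, le_rfl, .refl _ _⟩
      (by rintro ⟨j, hj, hj'⟩; have := hlast j ⟨x, hx, hj'⟩; omega)
  have hfar' : Far G t S' (e '' Set.Ici p) := by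
    rintro y hy _ ⟨j, hj, rfl⟩ m hm
    by_contra! hlt
    -- If the hit vertex were closer than `t`, its neighbour `v` would already be within `t`. Hence
    -- stopping at the first hit guarantees distance at least `t`.
    obtain rfl := hun y hy ⟨j, hj, hm.mono hlt.le⟩
    exact hPv ⟨j, hj, ((near_of_adj hvz).trans hm).mono (by omega)⟩
  refine ⟨T ∪ S', Set.subset_union_left, ?_⟩
  by_cases hf : Far G t S S'
  · refine .inr ⟨h.conn_left, h.conn_right.union hcS' hx hxS', h.far.union_right hf,
      h.far_left.mono le_rfl subset_rfl (tail_subset (by omega)),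
      (h.far_right.mono le_rfl subset_rfl (tail_subset (by omega))).union_left hfar',
      ⟨p, le_rfl, hp⟩, ⟨j, hj, z, .inr hz, hzj⟩, h.subset_left, ?_⟩
    rintro y (hy | hy)
    · exact h.subset_right y hy
    · exact near_of_mem_advance (hS' hy)
  · left
    unfold Far at hf
    push Not at hf
    obtain ⟨y, hy, y', hy', m, hm, hmt⟩ := hf
    refine ⟨h.conn_left, h.conn_right, h.far,
      h.far_left.mono le_rfl subset_rfl (tail_subset hsq),
      h.far_right.mono le_rfl subset_rfl (tail_subset hsq), ⟨y, hy, ?_⟩,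
      ⟨x, hx, hxq.mono (by omega)⟩, h.subset_left, h.subset_right⟩
    -- The vertex `y'` close to `S` cannot lie on `e` between `q` and `p`, since `S` is far from
    -- that tail. So it lies on the short connection to `e q`, and `S` comes within `2 * t` of `e
    -- q`, the new centre.
    rcases hS' hy' with ⟨i, k, hik, -, _, rfl, hk⟩ | ⟨i, hi, rfl⟩
    · exact (hm.trans hk).mono (by omega)
    · have := h.far_left y hy _ ⟨i, hsq.trans hi.1, rfl⟩ m hm
      omega

/-- Compare the last contacts of `S` and `T` with `e`. If they coincide, that vertex is the centre;
otherwise the set that lags behind is prolonged along `e`, and either a centre appears or the tail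
starts strictly later, so `M - s` drops. -/
theorem IsPretripod.exists_tripod {e : ℕ → V}
    (he : ∀ i, e i = e (i + 1) ∨ G.Adj (e i) (e (i + 1)))
    {M : ℕ} (hM : ∀ i, M ≤ i → e i = e M) {t : ℕ} :
    ∀ {s : ℕ} {S T : Set V}, s ≤ M → IsPretripod G e t s S T →
      ∃ s' S' T', S ⊆ S' ∧ T ⊆ T' ∧ IsTripod G e t s' S' T' := by
  intro s
  induction hn : M - s using Nat.strong_induction_on generalizing s with
  | _ n ih =>
    intro S T hs h
    obtain ⟨p, hsp, hpM, hp, hlp⟩ :=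
      exists_last_index hM (fun v => ∃ x ∈ S, Near G t x v) hs h.near_left
    obtain ⟨q, hsq, hqM, hq, hlq⟩ :=
      exists_last_index hM (fun v => ∃ x ∈ T, Near G t x v) hs h.near_right
    rcases lt_trichotomy q p with hqp | rfl | hqp
    · obtain ⟨T', hT, h' | h'⟩ := h.step he hsq hqp hp hq
        (fun j hj => by have := hlq j hj; omega)
      · exact ⟨q, S, T, subset_rfl, subset_rfl, h'⟩
      · obtain ⟨s', S'', T'', hS'', hT'', h''⟩ := ih (M - p) (by omega) rfl hpM h'
        exact ⟨s', S'', T'', hS'', hT.trans hT'', h''⟩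
    · obtain ⟨x, hx, hxp⟩ := hp
      obtain ⟨y, hy, hyp⟩ := hq
      exact ⟨q, S, T, subset_rfl, subset_rfl, h.conn_left, h.conn_right, h.far,
        h.far_left.mono le_rfl subset_rfl (tail_subset hsp),
        h.far_right.mono le_rfl subset_rfl (tail_subset hsp), ⟨x, hx, hxp.mono (by omega)⟩,
        ⟨y, hy, hyp.mono (by omega)⟩, h.subset_left, h.subset_right⟩
    · obtain ⟨S', hS, h' | h'⟩ := h.swap.step he hsp hqp hq hp
        (fun j hj => by have := hlp j hj; omega)
      · exact ⟨p, S, T, subset_rfl, subset_rfl, h'.swap⟩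
      · obtain ⟨s', S'', T'', hS'', hT'', h''⟩ := ih (M - q) (by omega) rfl hqM h'.swap
        exact ⟨s', S'', T'', hS.trans hS'', hT'', h''⟩

/-- If the last vertex of `e` is far from `a`, so is the tail after the last visit near `a`. -/
theorem far_tail_of_last {e : ℕ → V} (he : ∀ i, e i = e (i + 1) ∨ G.Adj (e i) (e (i + 1)))
    {M : ℕ} (hM : ∀ i, M ≤ i → e i = e M) {t p : ℕ} {a : V} (haM : Far G t {a} {e M})
    (hlast : ∀ j, Near G t a (e j) → j ≤ p ∨ p = M) : Far G t {a} (e '' Set.Ici p) := by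
  rintro _ rfl _ ⟨j, hj, rfl⟩ m hm
  have hj' : p ≤ j := hj
  by_contra! hlt
  rcases hlast j (hm.mono hlt.le) with h | rfl
  · obtain rfl : j = p := le_antisymm h hj'
    -- A vertex at distance less than `t` has its successor within `t`, so it is not the last such
    -- vertex.
    rcases hlast (j + 1) ((hm.trans (near_succ he j)).mono (by omega)) with h | rfl
    · omega
    · have := haM _ rfl _ rfl m hm
      omega
  · rw [hM j hj'] at hm
    have := haM _ rfl _ rfl m hm
    omega

/-- Past its last contact `e p`, the sequence is far from both `a` and `r`. Growing `r` along `e`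
until it first comes within `t` of that tail or of `a` gives a pretripod in the former case and a
tripod centred at `e p` in the latter. -/
theorem exists_tripod_of_le {e : ℕ → V} (he : ∀ i, e i = e (i + 1) ∨ G.Adj (e i) (e (i + 1)))
    {M : ℕ} (hM : ∀ i, M ≤ i → e i = e M) {t p q : ℕ} {a r : V} (har : Far G t {a} {r})
    (haM : Far G t {a} {e M}) (hrM : Far G t {r} {e M}) (hpM : p ≤ M) (hqp : q ≤ p)
    (hp : Near G t a (e p)) (hq : Near G t r (e q))
    (hlp : ∀ j, Near G t a (e j) → j ≤ p ∨ p = M) (hlq : ∀ j, Near G t r (e j) → j ≤ q ∨ q = M) :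
    ∃ s S T, a ∈ S ∧ r ∈ T ∧ IsTripod G e t s S T := by
  have hfa := far_tail_of_last he hM haM hlp
  have hfr := (far_tail_of_last he hM hrM hlq).mono le_rfl subset_rfl (tail_subset hqp)
  have hsa : ∀ x ∈ ({a} : Set V), ∃ i, Near G t x (e i) := by rintro _ rfl; exact ⟨p, hp⟩
  have hsr : ∀ x ∈ ({r} : Set V), ∃ i, Near G t x (e i) := by rintro _ rfl; exact ⟨q, hq⟩
  by_cases hr : Near G (2 * t) r (e p)
  · exact ⟨p, {a}, {r}, rfl, rfl, conn_singleton a, conn_singleton r, har, hfa, hfr,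
      ⟨a, rfl, hp.mono (by omega)⟩, ⟨r, rfl, hr⟩, hsa, hsr⟩
  have hqp' : q < p := by
    refine lt_of_le_of_ne hqp ?_
    rintro rfl
    exact hr (hq.mono (by omega))
  obtain ⟨S', z, hS', hcS', hrS', hz, hPz, hun, v, hv, hPv, hvz⟩ :=
    exists_advance he hqp hq (fun v => (∃ j, p ≤ j ∧ Near G t v (e j)) ∨ Near G t v a)
      (.inl ⟨p, le_rfl, .refl _ _⟩) (by
        rintro (⟨j, hj, hj'⟩ | h)
        · have := hlq j hj'
          omega
        · exact hr ((h.trans hp).mono (by omega)))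
  have hf1 : Far G t S' (e '' Set.Ici p) := by
    rintro y hy _ ⟨j, hj, rfl⟩ m hm
    by_contra! hlt
    obtain rfl := hun y hy (.inl ⟨j, hj, hm.mono hlt.le⟩)
    exact hPv (.inl ⟨j, hj, ((near_of_adj hvz).trans hm).mono (by omega)⟩)
  have hf2 : Far G t {a} S' := by
    refine Far.symm ?_
    rintro y hy _ rfl m hm
    by_contra! hlt
    obtain rfl := hun y hy (.inr (hm.mono hlt.le))
    exact hPv (.inr (((near_of_adj hvz).trans hm).mono (by omega)))
  have hsS : ∀ x ∈ S', ∃ i, Near G t x (e i) := fun x hx => near_of_mem_advance (hS' hx)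
  rcases hPz with ⟨j, hj, hzj⟩ | hza
  · have hpre : IsPretripod G e t p {a} S' :=
      ⟨conn_singleton a, hcS', hf2, hfa, hf1, ⟨p, le_rfl, a, rfl, hp⟩, ⟨j, hj, z, hz, hzj⟩,
        hsa, hsS⟩
    obtain ⟨s, S, T, hS, hT, h⟩ := hpre.exists_tripod he hM hpM
    exact ⟨s, S, T, hS rfl, hT hrS', h⟩
  · exact ⟨p, {a}, S', rfl, hrS', conn_singleton a, hcS', hf2, hfa, hf1,
      ⟨a, rfl, hp.mono (by omega)⟩, ⟨z, hz, (hza.trans hp).mono (by omega)⟩, hsa, hsS⟩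

/-- A sequence through `a` and `r` that ends in a third vertex contains a coarse tripod with these
three ends. -/
theorem exists_tripod {e : ℕ → V} (he : ∀ i, e i = e (i + 1) ∨ G.Adj (e i) (e (i + 1)))
    {M : ℕ} (hM : ∀ i, M ≤ i → e i = e M) {t : ℕ} {a r : V} (ha : ∃ i, e i = a)
    (hr : ∃ i, e i = r) (har : Far G t {a} {r})
    (haM : Far G t {a} {e M}) (hrM : Far G t {r} {e M}) :
    ∃ s S T, a ∈ S ∧ r ∈ T ∧ IsTripod G e t s S T := by
  obtain ⟨i, hi⟩ := ha
  obtain ⟨j, hj⟩ := hr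
  obtain ⟨p, -, hpM, hp, hlp⟩ := exists_last_index hM (fun v => Near G t a v) (Nat.zero_le M)
    ⟨i, Nat.zero_le _, hi ▸ .refl _ _⟩
  obtain ⟨q, -, hqM, hq, hlq⟩ := exists_last_index hM (fun v => Near G t r v) (Nat.zero_le M)
    ⟨j, Nat.zero_le _, hj ▸ .refl _ _⟩
  rcases le_total q p with hqp | hqp
  · exact exists_tripod_of_le he hM har haM hrM hpM hqp hp hq hlp hlq
  · obtain ⟨s, S, T, hS, hT, h⟩ :=
      exists_tripod_of_le he hM har.symm hrM haM hqM hqp hq hp hlq hlp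
    exact ⟨s, T, S, hT, hS, h.swap⟩

/-! ### Configurations of dipods and tripods. -/

/-- A connected set of vertices with a finite set of exceptional vertices and a weight. -/
structure Component (V : Type u) where
  carrier : Set V
  centers : Finset V
  weight : ℕ

/-- A connected set containing two vertices of `A` at distance at least `n`. -/
def Component.IsDipod (G : SimpleGraph V) (A : Set V) (n : ℕ) (Z : Component V) : Prop :=
  Conn G Z.carrier ∧ ∃ a b, a ∈ A ∧ b ∈ A ∧ a ∈ Z.carrier ∧ b ∈ Z.carrier ∧
    a ∈ Z.centers ∧ b ∈ Z.centers ∧ Far G n {a} {b}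

/-- The data of three legs with ends in `A`, pairwise at distance at least `n`, that are joined by
shortest paths to the centre `c`. -/
structure IsTripodWith (G : SimpleGraph V) (A : Set V) (n : ℕ) (Z : Component V) (r : ℕ) (c : V)
    (a : Fin 3 → V) (L : Fin 3 → Set V) : Prop where
  end_mem : ∀ k, a k ∈ A
  end_mem_leg : ∀ k, a k ∈ L k
  conn : ∀ k, Conn G (L k)
  near : ∀ k, ∃ x ∈ L k, Near G r x c
  far_center : ∀ k, L k = {a k} ∨ Far G r (L k) {c}
  far : ∀ k l, k ≠ l → Far G n (L k) (L l)
  carrier_eq : Z.carrier = ⋃ k, (L k ∪ hull G r c (L k))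
  end_mem_centers : ∀ k, a k ∈ Z.centers
  center_mem : c ∈ Z.centers

/-- A component is a dipod of weight `4` or a tripod of weight `7`. -/
def Component.IsGood (G : SimpleGraph V) (A : Set V) (K n : ℕ) (Z : Component V) : Prop :=
  Z.centers.card ≤ 4 ∧ (Z.weight = 4 ∧ Z.IsDipod G A n ∨
    Z.weight = 7 ∧ ∃ r c a L, r ≤ K ∧ IsTripodWith G A n Z r c a L)

theorem Component.IsDipod.mono {A : Set V} {m n : ℕ} {Z : Component V} (h : Z.IsDipod G A n)
    (hmn : m ≤ n) : Z.IsDipod G A m := by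
  obtain ⟨hc, a, b, h1, h2, h3, h4, h5, h6, h7⟩ := h
  exact ⟨hc, a, b, h1, h2, h3, h4, h5, h6, h7.mono hmn subset_rfl subset_rfl⟩

theorem Component.IsGood.mono {A : Set V} {K m n : ℕ} {Z : Component V} (h : Z.IsGood G A K n)
    (hmn : m ≤ n) : Z.IsGood G A K m := by
  refine ⟨h.1, h.2.imp (fun h => ⟨h.1, h.2.mono hmn⟩) ?_⟩
  rintro ⟨hw, r, c, a, L, hr, h⟩
  exact ⟨hw, r, c, a, L, hr, h.1, h.2, h.3, h.4, h.5,
    fun k l hkl => (h.6 k l hkl).mono hmn subset_rfl subset_rfl, h.7, h.8, h.9⟩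

/-- A list of components that are pairwise at distance at least `n`. -/
structure IsConfig (G : SimpleGraph V) (A : Set V) (K n : ℕ) (l : List (Component V)) : Prop where
  good : ∀ Z ∈ l, Z.IsGood G A K n
  far : l.Pairwise fun Z Z' => Far G n Z.carrier Z'.carrier

theorem IsConfig.mono {A : Set V} {K m n : ℕ} {l : List (Component V)} (h : IsConfig G A K n l)
    (hmn : m ≤ n) : IsConfig G A K m l :=
  ⟨fun Z hZ => (h.good Z hZ).mono hmn, h.far.imp fun h => h.mono hmn subset_rfl subset_rfl⟩

theorem IsConfig.perm {A : Set V} {K n : ℕ} {l l' : List (Component V)}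
    (h : IsConfig G A K n l) (hp : l.Perm l') : IsConfig G A K n l' :=
  ⟨fun Z hZ => h.good Z (hp.mem_iff.mpr hZ), (hp.pairwise_iff fun h => h.symm).mp h.far⟩

theorem IsConfig.cons {A : Set V} {K n : ℕ} {l : List (Component V)} {Z : Component V}
    (h : IsConfig G A K n l) (hZ : Z.IsGood G A K n)
    (hf : ∀ Z' ∈ l, Far G n Z.carrier Z'.carrier) : IsConfig G A K n (Z :: l) :=
  ⟨by simpa using ⟨hZ, h.good⟩, List.pairwise_cons.mpr ⟨hf, h.far⟩⟩

theorem IsConfig.of_cons {A : Set V} {K n : ℕ} {l : List (Component V)} {Z : Component V}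
    (h : IsConfig G A K n (Z :: l)) : IsConfig G A K n l :=
  ⟨fun Z' hZ' => h.good Z' (List.mem_cons_of_mem _ hZ'), (List.pairwise_cons.mp h.far).2⟩

/-- The total weight of a list of components. -/
def totalWeight (l : List (Component V)) : ℕ := (l.map Component.weight).sum

theorem IsConfig.totalWeight_le {A : Set V} {K n : ℕ} {l : List (Component V)}
    (h : IsConfig G A K n l) : totalWeight l ≤ 7 * l.length := by
  induction l with
  | nil => simp [totalWeight]
  | cons Z l ih =>
    have h1 := ih h.of_cons
    have h2 := (h.good Z (by simp)).2
    simp only [totalWeight, List.map_cons, List.sum_cons, List.length_cons] at *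
    rcases h2 with ⟨h2, -⟩ | ⟨h2, -⟩ <;> omega

theorem conn_leg_union_hull {n : ℕ} {c x : V} {L : Set V} (hL : Conn G L) (hx : x ∈ L)
    (h : Near G n x c) : Conn G (L ∪ hull G n c L) :=
  hL.union (conn_hull n c L) hx (mem_hull_of_near hx h)

theorem exists_aPath_of_far {A : Set V} {n : ℕ} (hn : 1 ≤ n) {S : Set V} (hS : Conn G S) {a b : V}
    (ha : a ∈ A) (hb : b ∈ A) (haS : a ∈ S) (hbS : b ∈ S) (hab : Far G n {a} {b}) :
    ∃ P : APath G A, P.verts ⊆ S ∧ P.IsCoarse n := by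
  classical
  obtain ⟨w, hw⟩ := hS a haS b hbS
  have hne : a ≠ b := by
    rintro rfl
    have := hab a rfl a rfl 0 (.refl _ _)
    omega
  refine ⟨⟨a, b, w.toPath, w.toPath.2, ?_, ha, hb⟩,
    fun v hv => hw v (w.support_toPath_subset_support hv),
    le_edist_of_forall_near (hab a rfl b rfl)⟩
  rw [SimpleGraph.Walk.length_support]
  have : (w.toPath : G.Walk a b).length ≠ 0 :=
    fun h => hne (SimpleGraph.Walk.eq_of_length_eq_zero h)
  omega

theorem Component.IsGood.exists_aPath {A : Set V} {K n : ℕ} (hn : 1 ≤ n) {Z : Component V}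
    (h : Z.IsGood G A K n) : ∃ P : APath G A, P.verts ⊆ Z.carrier ∧ P.IsCoarse n := by
  rcases h.2 with ⟨-, hc, a, b, ha, hb, haZ, hbZ, -, -, hab⟩ | ⟨-, r, c, a, L, -, h⟩
  · exact exists_aPath_of_far hn hc ha hb haZ hbZ hab
  · have hc : ∀ k, c ∈ L k ∪ hull G r c (L k) ∧ Conn G (L k ∪ hull G r c (L k)) := fun k => by
      obtain ⟨x, hx, hxc⟩ := h.near k
      exact ⟨.inr (center_mem_hull hx hxc), conn_leg_union_hull (h.conn k) hx hxc⟩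
    obtain ⟨P, hP, hPc⟩ := exists_aPath_of_far hn ((hc 0).2.union (hc 1).2 (hc 0).1 (hc 1).1)
      (h.end_mem 0) (h.end_mem 1) (.inl (.inl (h.end_mem_leg 0))) (.inr (.inl (h.end_mem_leg 1)))
      ((h.far 0 1 (by decide)).mono le_rfl (by simpa using h.end_mem_leg 0)
        (by simpa using h.end_mem_leg 1))
    refine ⟨P, hP.trans ?_, hPc⟩
    rw [h.carrier_eq]
    exact Set.union_subset (Set.subset_iUnion (fun k => L k ∪ hull G r c (L k)) 0)
      (Set.subset_iUnion (fun k => L k ∪ hull G r c (L k)) 1)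

/-! ### Improving a configuration. -/

/-- A connected set through three vertices is traversed by a sequence ending in the third. -/
theorem Conn.exists_seq {U : Set V} (hU : Conn G U) {a r b : V} (ha : a ∈ U) (hr : r ∈ U)
    (hb : b ∈ U) : ∃ (e : ℕ → V) (M : ℕ), (∀ i, e i = e (i + 1) ∨ G.Adj (e i) (e (i + 1))) ∧
      (∀ i, M ≤ i → e i = e M) ∧ e M = b ∧ (∃ i, e i = a) ∧ (∃ i, e i = r) ∧ ∀ i, e i ∈ U := by
  obtain ⟨w, hw⟩ := hU a ha r hr
  obtain ⟨w', hw'⟩ := hU r hr b hb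
  refine ⟨(w.append w').getVert, (w.append w').length, fun i => ?_, fun i hi => ?_, ?_,
    ⟨0, by simp⟩, ⟨w.length, by simp [SimpleGraph.Walk.getVert_append]⟩, fun i => ?_⟩
  · rcases lt_or_ge i (w.append w').length with h | h
    · exact .inr ((w.append w').adj_getVert_succ h)
    · left
      rw [SimpleGraph.Walk.getVert_of_length_le _ h,
        SimpleGraph.Walk.getVert_of_length_le _ (by omega)]
  · rw [SimpleGraph.Walk.getVert_of_length_le _ hi, SimpleGraph.Walk.getVert_length]
  · exact (w.append w').getVert_length
  · have := (w.append w').getVert_mem_support i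
    rw [SimpleGraph.Walk.mem_support_append_iff] at this
    exact this.elim (hw _) (hw' _)

/-- A connected set from `a` to the vicinity of `c` can be cut off where it comes near `c`. -/
theorem Conn.exists_leg {S : Set V} (hS : Conn G S) {n : ℕ} {a c x : V} (ha : a ∈ S) (hx : x ∈ S)
    (hxc : Near G n x c) : ∃ L ⊆ S, a ∈ L ∧ Conn G L ∧ (∃ y ∈ L, Near G n y c) ∧
      (L = {a} ∨ Far G n L {c}) := by
  obtain ⟨w, hw⟩ := hS a ha x hx
  obtain ⟨L, z, hL, hc, haL, hz, hPz, hun, hor⟩ :=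
    exists_first_hit w (fun v => Near G n v c) hxc
  refine ⟨L, fun v hv => hw v (hL v hv), haL, hc, ⟨z, hz, hPz⟩, hor.imp And.left ?_⟩
  rintro ⟨v, hv, hPv, hvz⟩ y hy _ rfl m hm
  by_contra! hlt
  obtain rfl := hun y hy (hm.mono hlt.le)
  exact hPv (((near_of_adj hvz).trans hm).mono (by omega))

/-- A connected set with three ends in `A` contains a tripod up to small distance. -/
theorem exists_tripodWith [DecidableEq V] {A : Set V} {U : Set V} (hU : Conn G U) {t : ℕ}
    {a r b : V}
    (ha : a ∈ U) (hr : r ∈ U) (hb : b ∈ U) (haA : a ∈ A) (hrA : r ∈ A) (hbA : b ∈ A)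
    (har : Far G t {a} {r}) (hab : Far G t {a} {b}) (hrb : Far G t {r} {b}) :
    ∃ Z : Component V, Z.weight = 7 ∧ Z.centers.card ≤ 4 ∧
      (∃ c a L, IsTripodWith G A t Z (2 * t) c a L) ∧
      ∀ v ∈ Z.carrier, ∃ x ∈ U, Near G (2 * t) v x := by
  obtain ⟨e, M, he, hM, hMb, hea, her, heU⟩ := hU.exists_seq ha hr hb
  obtain ⟨s, S, T, haS, hrT, h⟩ := exists_tripod he hM hea her har (hMb ▸ hab) (hMb ▸ hrb)
  have hbt : b ∈ e '' Set.Ici s :=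
    ⟨max s M, Set.mem_Ici.mpr (le_max_left _ _), by rw [hM _ (le_max_right _ _), hMb]⟩
  obtain ⟨x, hx, hxc⟩ := h.near_left
  obtain ⟨y, hy, hyc⟩ := h.near_right
  -- Each leg is cut at its first vertex within `2 * t` of the centre, which provides `far_center`.
  obtain ⟨L0, hL0, ha0, hc0, hn0, hf0⟩ := h.conn_left.exists_leg haS hx hxc
  obtain ⟨L1, hL1, ha1, hc1, hn1, hf1⟩ := h.conn_right.exists_leg hrT hy hyc
  obtain ⟨L2, hL2, ha2, hc2, hn2, hf2⟩ :=
    (conn_image_of_ordConnected he (Set.Ici s)).exists_leg hbt ⟨s, Set.self_mem_Ici, rfl⟩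
      (.refl (2 * t) (e s))
  have h01 := h.far.mono le_rfl hL0 hL1
  have h02 := h.far_left.mono le_rfl hL0 hL2
  have h12 := h.far_right.mono le_rfl hL1 hL2
  let L : Fin 3 → Set V := ![L0, L1, L2]
  refine ⟨⟨⋃ k, (L k ∪ hull G (2 * t) (e s) (L k)), {a, r, b, e s}, 7⟩, rfl, Finset.card_le_four,
    ⟨e s, ![a, r, b], L, ⟨?_, ?_, ?_, ?_, ?_, ?_, rfl, ?_, by simp⟩⟩, ?_⟩
  · intro k; fin_cases k <;> assumption
  · intro k; fin_cases k <;> assumption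
  · intro k; fin_cases k <;> assumption
  · intro k; fin_cases k <;> assumption
  · intro k; fin_cases k <;> assumption
  · intro k l hkl
    fin_cases k <;> fin_cases l <;>
      first | exact absurd rfl hkl | assumption | (apply Far.symm; assumption)
  · intro k; fin_cases k <;> simp
  · intro v hv
    obtain ⟨k, hv | hv⟩ := Set.mem_iUnion.mp hv
    · have : ∃ i, Near G (2 * t) v (e i) := by
        fin_cases k
        · obtain ⟨i, hi⟩ := h.subset_left v (hL0 hv)
          exact ⟨i, hi.mono (by omega)⟩
        · obtain ⟨i, hi⟩ := h.subset_right v (hL1 hv)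
          exact ⟨i, hi.mono (by omega)⟩
        · obtain ⟨i, -, rfl⟩ := hL2 hv
          exact ⟨i, .refl _ _⟩
      obtain ⟨i, hi⟩ := this
      exact ⟨e i, heU i, hi⟩
    · exact ⟨e s, heU s, near_of_mem_hull hv⟩

/-- A shortest path from `x` to `w` keeps its distance from a set that is far from `x`. -/
theorem far_hull_of_far {m n : ℕ} {w x : V} {T : Set V} (h : Far G (m + n) {x} T) :
    Far G m (hull G n w {x}) T := by
  rintro v ⟨i, j, hij, -, _, rfl, hj⟩ y hy l hl
  have := h _ rfl y hy _ (hj.symm.trans hl)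
  omega

/-- Three legs of a tripod, one of which is extended by a connected set `S`, contain two
connected sets with two ends each that are far from each other. -/
theorem IsTripodWith.exists_split [DecidableEq V] {A : Set V} {K g t r : ℕ} {Z : Component V}
    {c : V} {a : Fin 3 → V} {L : Fin 3 → Set V} (h : IsTripodWith G A (8 * t) Z r c a L)
    (hr : r ≤ K) (hg : 8 * t + K ≤ g) {S : Set V} (hS : Conn G S) {b w x : V} (hbA : b ∈ A)
    (hb : b ∈ S) (hw : w ∈ S) (hx : x ∈ Z.carrier) (hwx : Near G (4 * t) w x)
    (hSZ : ∀ v ∈ S, ∀ y ∈ Z.carrier, Near G (4 * t) v y → v = w)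
    (hav : ∀ v ∈ S, ∀ y ∈ Z.centers, ¬ Near G g v y) :
    ∃ Z₁ Z₂ : Component V, Z₁.weight = 4 ∧ Z₂.weight = 4 ∧ Z₁.centers.card ≤ 4 ∧
      Z₂.centers.card ≤ 4 ∧ Z₁.IsDipod G A (4 * t) ∧ Z₂.IsDipod G A (4 * t) ∧
      Far G (4 * t) Z₁.carrier Z₂.carrier ∧
      Z₁.carrier ⊆ Z.carrier ∪ hull G (4 * t) w {x} ∪ S ∧ Z₂.carrier ⊆ Z.carrier := by
  have hwc : ¬ Near G g w c := hav w hw c h.center_mem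
  have hsub : ∀ k, L k ∪ hull G r c (L k) ⊆ Z.carrier := fun k => by
    rw [h.carrier_eq]
    exact Set.subset_iUnion (fun k => L k ∪ hull G r c (L k)) k
  obtain ⟨k, hxk⟩ : ∃ k, x ∈ L k := by
    rw [h.carrier_eq] at hx
    obtain ⟨k, hx | hx⟩ := Set.mem_iUnion.mp hx
    · exact ⟨k, hx⟩
    · exact absurd ((hwx.trans (near_of_mem_hull hx)).mono (by omega)) hwc
  -- A one-vertex leg would make `x` an end, and `w` avoids the ends.
  have hfc : Far G r (L k) {c} := by
    refine (h.far_center k).resolve_left fun hk => ?_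
    rw [hk] at hxk
    obtain rfl : x = a k := hxk
    exact hav w hw _ (h.end_mem_centers k) (hwx.mono (by omega))
  obtain ⟨k₁, k₂, hk₁, hk₂, hk₁₂⟩ : ∃ k₁ k₂ : Fin 3, k ≠ k₁ ∧ k ≠ k₂ ∧ k₁ ≠ k₂ := by
    clear * -; revert k; decide
  have hcc : ∀ k, c ∈ hull G r c (L k) ∧ Conn G (L k ∪ hull G r c (L k)) := fun k => by
    obtain ⟨x, hx, hxc⟩ := h.near k
    exact ⟨center_mem_hull hx hxc, conn_leg_union_hull (h.conn k) hx hxc⟩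
  have hfar : ∀ l, k ≠ l →
      Far G (4 * t) (L k ∪ hull G (4 * t) w {x} ∪ S) (L l ∪ hull G r c (L l)) := by
    intro l hkl
    have hHull : Far G (4 * t) (hull G (4 * t) w {x}) (L l ∪ hull G r c (L l)) := by
      refine Far.union_right ?_ ?_
      · exact far_hull_of_far ((h.far k l hkl).mono (by omega) (by simpa using hxk) subset_rfl)
      · intro v hv y hy m hm
        by_contra! hlt
        exact hwc ((((near_of_mem_hull hv).symm.trans hm).trans (near_of_mem_hull hy)).mono
          (by omega))
    refine (Far.union_left ?_ hHull).union_left ?_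
    · refine ((h.far k l hkl).mono (by omega) subset_rfl subset_rfl).union_right ?_
      rintro v hv y ⟨i, j, hij, hi, z, hz, hj⟩ m hm
      -- Here `m + i ≥ r` and `m + j ≥ 8 * t`, while `i + j ≤ r`; adding gives `m ≥ 4 * t`. Hence
      -- the loss is a factor 2, however large `r` is.
      have h1 := hfc v hv c rfl _ (hm.trans hi)
      have h2 := h.far k l hkl v hv z hz _ (hm.trans hj)
      omega
    · intro v hv y hy m hm
      by_contra! hlt
      -- Only `w` comes this close to `Z`, and `w` belongs to the hull treated above.
      obtain rfl := hSZ v hv y (hsub l hy) (hm.mono hlt.le)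
      have := hHull v (center_mem_hull (Set.mem_singleton x) hwx.symm) y hy m hm
      omega
  refine ⟨⟨L k ∪ hull G (4 * t) w {x} ∪ S, {a k, b}, 4⟩,
    ⟨(L k₁ ∪ hull G r c (L k₁)) ∪ (L k₂ ∪ hull G r c (L k₂)), {a k₁, a k₂}, 4⟩, rfl, rfl,
    Finset.card_le_two.trans (by omega), Finset.card_le_two.trans (by omega), ?_, ?_, ?_, ?_, ?_⟩
  · refine ⟨((h.conn k).union (conn_hull _ _ _) hxk
      (mem_hull_of_near (Set.mem_singleton x) hwx.symm)).union hS
      (.inr (center_mem_hull (Set.mem_singleton x) hwx.symm)) hw, a k, b, h.end_mem k, hbA,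
      .inl (.inl (h.end_mem_leg k)), .inr hb, by simp, by simp, ?_⟩
    rintro _ rfl _ rfl m hm
    by_contra! hlt
    exact hav _ hb _ (h.end_mem_centers k) (hm.symm.mono (by omega))
  · refine ⟨(hcc k₁).2.union (hcc k₂).2 (.inr (hcc k₁).1) (.inr (hcc k₂).1), a k₁, a k₂,
      h.end_mem _, h.end_mem _, .inl (.inl (h.end_mem_leg _)), .inr (.inl (h.end_mem_leg _)),
      by simp, by simp, (h.far _ _ hk₁₂).mono (by omega) (by simpa using h.end_mem_leg k₁)
        (by simpa using h.end_mem_leg k₂)⟩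
  · exact (hfar k₁ hk₁).union_right (hfar k₂ hk₂)
  · exact Set.union_subset_union_left _ (Set.union_subset_union_left _
      (Set.subset_union_left.trans (hsub k)))
  · exact Set.union_subset (hsub k₁) (hsub k₂)

/-- A dipod extended by a connected set with an end in `A` contains a tripod. -/
theorem Component.IsDipod.exists_tripodWith [DecidableEq V] {A : Set V} {g t : ℕ}
    {Z : Component V} (h : Z.IsDipod G A (8 * t)) (hg : 8 * t ≤ g) {S : Set V} (hS : Conn G S)
    {b w x : V} (hbA : b ∈ A) (hb : b ∈ S) (hw : w ∈ S) (hx : x ∈ Z.carrier)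
    (hwx : Near G (4 * t) w x) (hav : ∀ v ∈ S, ∀ y ∈ Z.centers, ¬ Near G g v y) :
    ∃ Z' : Component V, Z'.weight = 7 ∧ Z'.centers.card ≤ 4 ∧
      (∃ c a L, IsTripodWith G A t Z' (2 * t) c a L) ∧
      ∀ v ∈ Z'.carrier, ∃ y ∈ Z.carrier ∪ hull G (4 * t) w {x} ∪ S, Near G (2 * t) v y := by
  obtain ⟨hc, p, q, hp, hq, hpZ, hqZ, hpX, hqX, hpq⟩ := h
  have hfar : ∀ y ∈ Z.centers, Far G t {b} {y} := by
    rintro y hy _ rfl _ rfl m hm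
    by_contra! hlt
    exact hav _ hb _ hy (hm.mono (by omega))
  have hU : Conn G (Z.carrier ∪ hull G (4 * t) w {x} ∪ S) :=
    (hc.union (conn_hull _ _ _) hx (mem_hull_of_near (Set.mem_singleton x) hwx.symm)).union hS
      (.inr (center_mem_hull (Set.mem_singleton x) hwx.symm)) hw
  exact CoarseGallai.exists_tripodWith hU (.inl (.inl hpZ)) (.inr hb) (.inl (.inl hqZ))
    hp hbA hq (hfar p hpX).symm (hpq.mono (by omega) subset_rfl subset_rfl) (hfar q hqX)

/-- A coarse `A`-path far from all exceptional vertices allows a configuration to be improved. -/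
theorem IsConfig.step {A : Set V} {K g t : ℕ} {l : List (Component V)}
    (h : IsConfig G A K (8 * t) l) (hK : 2 * t ≤ K) (hg : 8 * t + K ≤ g) (P : APath G A)
    (hP : P.IsCoarse g) (hav : ∀ Z ∈ l, ∀ v ∈ P.verts, ∀ y ∈ Z.centers, ¬ Near G g v y) :
    ∃ l', l'.length ≤ l.length + 1 ∧
      (IsConfig G A K t l' ∧ totalWeight l' = totalWeight l + 3 ∨
        IsConfig G A K (4 * t) l' ∧
          (totalWeight l' = totalWeight l + 1 ∨ totalWeight l' = totalWeight l + 4)) := by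
  classical
  -- The threshold is half the separation: a connection of length `4 * t` to one component stays `4
  -- * t` away from the others.
  by_cases hex : ∃ v ∈ P.walk.support, ∃ Z ∈ l, ∃ x ∈ Z.carrier, Near G (4 * t) v x
  · obtain ⟨v, hv, hPv⟩ := hex
    obtain ⟨S, w, hS, hcS, haS, hwS, ⟨Z, hZ, x, hx, hwx⟩, hun, -⟩ :=
      exists_first_hit (P.walk.takeUntil v hv)
        (fun v => ∃ Z ∈ l, ∃ x ∈ Z.carrier, Near G (4 * t) v x) hPv
    have hSP : ∀ v ∈ S, v ∈ P.verts := fun v hv' =>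
      P.walk.support_takeUntil_subset_support hv (hS v hv')
    obtain ⟨l', hl⟩ : ∃ l', l.Perm (Z :: l') := ⟨_, List.perm_cons_erase hZ⟩
    have hc := h.perm hl
    have hlen : l.length = l'.length + 1 := by simpa using hl.length_eq
    have hwt : totalWeight l = Z.weight + totalWeight l' := by
      simpa [totalWeight] using (hl.map Component.weight).sum_eq
    have hf := (List.pairwise_cons.mp hc.far).1
    have hmem : ∀ Z' ∈ l', Z' ∈ l := fun Z' hZ' => hl.mem_iff.mpr (List.mem_cons_of_mem _ hZ')
    have havZ : ∀ v ∈ S, ∀ y ∈ Z.centers, ¬ Near G g v y := fun v hv => hav Z hZ v (hSP v hv)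
    have hfU : ∀ Z' ∈ l',
        Far G (4 * t) (Z.carrier ∪ hull G (4 * t) w {x} ∪ S) Z'.carrier := by
      intro Z' hZ'
      have hHull : Far G (4 * t) (hull G (4 * t) w {x}) Z'.carrier :=
        far_hull_of_far ((hf Z' hZ').mono (by omega) (by simpa using hx) subset_rfl)
      refine (((hf Z' hZ').mono (by omega) subset_rfl subset_rfl).union_left hHull).union_left ?_
      intro v hv y hy m hm
      by_contra! hlt
      obtain rfl := hun v hv ⟨Z', hmem Z' hZ', y, hy, hm.mono hlt.le⟩
      have := hHull v (center_mem_hull (Set.mem_singleton x) hwx.symm) y hy m hm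
      omega
    rcases h.good Z hZ with ⟨-, ⟨hZw, hd⟩ | ⟨hZw, r, c, a, L, hr, hT⟩⟩
    · obtain ⟨Z', hw', hcard, ⟨c, a, L, hT⟩, hnear⟩ :=
        hd.exists_tripodWith (g := g) (by omega) hcS P.fst_mem haS hwS hx hwx havZ
      refine ⟨Z' :: l', by simp [hlen], .inl ⟨(hc.of_cons.mono (by omega)).cons
        ⟨hcard, .inr ⟨hw', 2 * t, c, a, L, hK, hT⟩⟩ ?_, ?_⟩⟩
      · intro Z'' hZ'' v hv y hy m hm
        -- The tripod strays at most `2 * t` from a set that is `4 * t` away from the other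
        -- components.
        obtain ⟨u, hu, hvu⟩ := hnear v hv
        have := hfU Z'' hZ'' u hu y hy _ (hvu.symm.trans hm)
        omega
      · simp only [totalWeight, List.map_cons, List.sum_cons] at hwt ⊢
        omega
    · obtain ⟨Z₁, Z₂, hw₁, hw₂, hX₁, hX₂, hd₁, hd₂, hfar, hs₁, hs₂⟩ :=
        hT.exists_split hr hg hcS P.fst_mem haS hwS hx hwx
          (fun v hv y hy hvy => hun v hv ⟨Z, hZ, y, hy, hvy⟩) havZ
      refine ⟨Z₁ :: Z₂ :: l', by simp [hlen], .inr ⟨((hc.of_cons.mono (by omega)).cons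
        ⟨hX₂, .inl ⟨hw₂, hd₂⟩⟩ fun Z' hZ' => (hf Z' hZ').mono (by omega) hs₂ subset_rfl).cons
        ⟨hX₁, .inl ⟨hw₁, hd₁⟩⟩ ?_, .inl ?_⟩⟩
      · rintro Z' hZ'
        rcases List.mem_cons.mp hZ' with rfl | hZ'
        · exact hfar
        · exact (hfU Z' hZ').mono le_rfl hs₁ subset_rfl
      · simp only [totalWeight, List.map_cons, List.sum_cons] at hwt ⊢
        omega
  · push Not at hex
    refine ⟨⟨P.verts, {P.fst, P.snd}, 4⟩ :: l, by simp, .inr ⟨(h.mono (by omega)).cons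
      ⟨Finset.card_le_two.trans (by omega), .inl ⟨rfl, conn_support P.walk, P.fst, P.snd,
        P.fst_mem, P.snd_mem, P.walk.start_mem_support, P.walk.end_mem_support, by simp, by simp,
        ?_⟩⟩ ?_, .inr ?_⟩⟩
    · rintro _ rfl _ rfl m hm
      have h1 : (g : ℕ∞) ≤ m := le_trans hP hm
      have h2 : g ≤ m := by exact_mod_cast h1
      omega
    · intro Z hZ v hv y hy m hm
      by_contra! hlt
      exact hex v hv Z hZ y hy (hm.mono hlt.le)
    · simp only [totalWeight, List.map_cons, List.sum_cons]
      omega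

/-! ### The weight argument and the conclusion. -/

theorem setDist_le_of_mem {X : Set V} {n : ℕ} {y v : V} (hy : y ∈ X) (h : Near G n y v) :
    setDist G X {v} ≤ n :=
  (iInf₂_le y hy).trans ((iInf₂_le v (Set.mem_singleton v)).trans h)

/-- A configuration at the scale belonging to its total weight leads to a packing or a hitting
set. -/
theorem exists_of_isConfig {A : Set V} {k d : ℕ} (hd : 1 ≤ d)
    (l : List (Component V)) (hl : l.length ≤ k)
    (h : IsConfig G A (d * 2 ^ (7 * k)) (d * 2 ^ (7 * k - totalWeight l)) l) :
    (∃ P : Fin k → APath G A, (∀ i, (P i).IsCoarse d) ∧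
      ∀ i j, i ≠ j → (d : ℕ∞) ≤ setDist G (P i).verts (P j).verts) ∨
    ∃ X : Finset V, X.card ≤ 4 * k - 4 ∧ ∀ P : APath G A, P.IsCoarse (d * 256 ^ k) →
      (P.verts ∩ ball G (X : Set V) (d * 256 ^ k)).Nonempty := by
  classical
  induction hn : 7 * k - totalWeight l using Nat.strong_induction_on generalizing l with
  | _ n ih =>
  rw [hn] at h
  rcases hl.eq_or_lt with rfl | hlt
  · left
    have hle : d ≤ d * 2 ^ n := Nat.le_mul_of_pos_right d (by positivity)
    have h' := h.mono hle
    choose P hP hPc using fun i : Fin l.length => (h'.good _ (l.get_mem i)).exists_aPath hd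
    refine ⟨P, hPc, fun i j hij => Far.le_setDist ?_⟩
    have hpw := List.pairwise_iff_get.mp h'.far
    rcases lt_or_gt_of_ne hij with hlt | hlt
    · exact (hpw i j hlt).mono le_rfl (hP i) (hP j)
    · exact (hpw j i hlt).symm.mono le_rfl (hP i) (hP j)
  · by_cases hX : ∃ X : Finset V, X.card ≤ 4 * k - 4 ∧
        ∀ P : APath G A, P.IsCoarse (d * 256 ^ k) →
          (P.verts ∩ ball G (X : Set V) (d * 256 ^ k)).Nonempty
    · exact .inr hX
    have hwl := h.totalWeight_le
    -- Fewer than `k` components weigh at most `7 * (k - 1)`, so the exponent is at least 7 and the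
    -- scale is divisible by 8.
    obtain ⟨m, rfl⟩ : ∃ m, n = m + 7 := ⟨n - 7, by omega⟩
    have hcard : ∀ l' : List (Component V), (∀ Z ∈ l', Z.centers.card ≤ 4) →
        (l'.toFinset.biUnion Component.centers).card ≤ 4 * l'.length := by
      intro l' hl'
      calc _ ≤ l'.toFinset.card * 4 :=
            Finset.card_biUnion_le_card_mul _ _ _ (fun Z hZ => hl' Z (List.mem_toFinset.mp hZ))
        _ ≤ l'.length * 4 := Nat.mul_le_mul_right _ (List.toFinset_card_le l')
        _ = _ := mul_comm _ _
    push Not at hX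
    obtain ⟨P, hP, hPX⟩ := hX (l.toFinset.biUnion Component.centers)
      ((hcard l fun Z hZ => (h.good Z hZ).1).trans (by omega))
    have hav : ∀ Z ∈ l, ∀ v ∈ P.verts, ∀ y ∈ Z.centers, ¬ Near G (d * 256 ^ k) v y := by
      intro Z hZ v hv y hy hnear
      have : v ∈ P.verts ∩ ball G
          ((l.toFinset.biUnion Component.centers : Finset V) : Set V) (d * 256 ^ k) :=
        ⟨hv, setDist_le_of_mem (by simpa using ⟨Z, hZ, hy⟩) hnear.symm⟩
      rw [hPX] at this
      exact this
    have hpow : d * 2 ^ (m + 7) = 8 * (d * 2 ^ (m + 4)) := by ring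
    have hmk : d * 2 ^ (m + 7) ≤ d * 2 ^ (7 * k) :=
      Nat.mul_le_mul_left _ (Nat.pow_le_pow_right (by omega) (by omega))
    -- The step needs `8 * t + K ≤ g`, where both summands are at most `d * 2 ^ (7 * k)`. The factor
    -- 2 fits into `2 ^ (8 * k)` since `k ≥ 1`, the list being shorter than `k`.
    have hgk : 2 * (d * 2 ^ (7 * k)) ≤ d * 256 ^ k := by
      have : (256 : ℕ) ^ k = 2 ^ (8 * k) := by rw [pow_mul]; norm_num
      rw [this, show 2 * (d * 2 ^ (7 * k)) = d * 2 ^ (7 * k + 1) by ring]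
      exact Nat.mul_le_mul_left _ (Nat.pow_le_pow_right (by omega) (by omega))
    rw [hpow] at h
    obtain ⟨l', hlen, ⟨hc, hw⟩ | ⟨hc, hw⟩⟩ := h.step (by omega) (by omega) P hP hav
    · refine ih (m + 4) (by omega) l' (by omega) ?_ (by omega)
      rwa [show 7 * k - totalWeight l' = m + 4 by omega]
    -- The scale only halves while the weight grows by 1 or 4, so monotonicity covers both cases.
    · refine ih (7 * k - totalWeight l') (by omega) l' (by omega) (hc.mono ?_) rfl
      rw [show 4 * (d * 2 ^ (m + 4)) = d * 2 ^ (m + 6) by ring]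
      exact Nat.mul_le_mul_left _ (Nat.pow_le_pow_right (by omega) (by omega))

end CoarseGallai

theorem theorem2 :
    ∃ (f : ℕ → ℕ) (g : ℕ → ℕ → ℕ),
      (∀ k : ℕ, 1 ≤ k → f k = 4 * k - 4) ∧
      (∀ k d : ℕ, 1 ≤ k → 1 ≤ d → g k d = d * 256 ^ k) ∧
      ∀ k d : ℕ, 1 ≤ k → 1 ≤ d →
        ∀ (V : Type*) [Finite V] (G : SimpleGraph V) (A : Set V),
          (∃ P : Fin k → CoarseGallai.APath G A,
            (∀ i, (P i).IsCoarse d) ∧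
            ∀ i j, i ≠ j → (d : ℕ∞) ≤ CoarseGallai.setDist G (P i).verts (P j).verts) ∨
          (∃ X : Finset V, X.card ≤ f k ∧
            ∀ P : CoarseGallai.APath G A, P.IsCoarse (g k d) →
              (P.verts ∩ CoarseGallai.ball G (X : Set V) (g k d)).Nonempty) := by
  refine ⟨fun k => 4 * k - 4, fun k d => d * 256 ^ k, fun _ _ => rfl, fun _ _ _ _ => rfl, ?_⟩
  intro k d _ hd V _ G A
  exact CoarseGallai.exists_of_isConfig hd [] (Nat.zero_le k) ⟨by simp, List.Pairwise.nil⟩
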